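/- Let $\lambda>0$ (wavelength), $\sigma_w^2>0$ (noise variance), and let $(\sigma_m^2)_{m\in\mathbb Z}$ be non-negative variances with finite sum $P=\sum_{m\in\mathbb Z}\sigma_m^2$. Let $\mathcal M\subset\mathbb Z$ be a finite set and let $\boldsymbol\beta=(\beta_m)_{m\in\mathcal M}$ have independent circular complex Gaussian components $\beta_m\sim\mathcal{CN}(0,\sigma_m^2)$. For a finite set $\mathcal S\subset\mathbb R$ of sensor positions let $$\hat{\boldsymbol f}_{\mathcal S}=\boldsymbol K_{\mathcal S}\boldsymbol\beta+\boldsymbol w,\qquad [\boldsymbol K_{\mathcal S}]_{x,m}=\operatorname{sinc}\bigl(m+\tfrac{2}{\lambda}x\bigr)\quad(x\in\mathcal S,\ m\in\mathcal M),\qquad \operatorname{sinc}(t)=\frac{\sin(\pi t)}{\pi t},$$ where $\boldsymbol w$ is independent of $\boldsymbol\beta$ and has independent components $w_x\sim\mathcal{CN}(0,\sigma_w^2)$, and let $I(\hat{\boldsymbol f}_{\mathcal S};\boldsymbol\beta)$ be the mutual information in nats. Let the aperture $\mathcal A\subset\mathbb R$ be a bounded interval, let $\delta>0$ and $c\in\mathbb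 R$, and let $\mathcal V=\{c+k\delta : k\in\mathbb Z\}\cap\mathcal A$ be the uniform $\delta$-spaced grid of positions in $\mathcal A$. Let $N\ge 0$ be an integer with $N\le|\mathcal V|$. Then $I(\hat{\boldsymbol f}_{\mathcal S};\boldsymbol\beta)<\infty$ for every finite $\mathcal S\subset\mathbb R$; there is a best on-grid design, that is, a maximizer $\mathcal S_d^\star$ of $I(\hat{\boldsymbol f}_{\mathcal S};\boldsymbol\beta)$ over the sets $\mathcal S\subseteq\mathcal V$ with $|\mathcal S|\le N$; and every such maximizer satisfies $$I(\hat{\boldsymbol f}_{\mathcal S_d^\star};\boldsymbol\beta)\ \le\ \sup_{\mathcal S\subseteq\mathcal A,\ |\mathcal S|\le N} I(\hat{\boldsymbol f}_{\mathcal S};\boldsymbol\beta)\ \le\ I(\hat{\boldsymbol f}_{\mathcal S_d^\star};\boldsymbol\beta)+N\log\Bigl(1+\frac{4\delta P(1+\delta)N^{3/2}}{\lambda\sigma_w^2}\Bigr).$$ In particular, if $\mathcal S^\star$ is a best continuous-aperture design, that is, a maximizer of $I(\hat{\boldsymbol f}_{\mathcal S};\boldsymbol\beta)$ over the sets $\mathcal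 S\subseteq\mathcal A$ with $|\mathcal S|\le N$, then $$I(\hat{\boldsymbol f}_{\mathcal S_d^\star};\boldsymbol\beta)\ \le\ I(\hat{\boldsymbol f}_{\mathcal S^\star};\boldsymbol\beta)\ \le\ I(\hat{\boldsymbol f}_{\mathcal S_d^\star};\boldsymbol\beta)+N\log\Bigl(1+\frac{4\delta P(1+\delta)N^{3/2}}{\lambda\sigma_w^2}\Bigr).$$ -/

import Mathlib

open MeasureTheory ProbabilityTheory
open scoped NNReal ENNReal

noncomputable section

/-- The circular complex Gaussian law `CN(0, v)`: the real and imaginary parts are independent real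
Gaussians with mean `0` and variance `v / 2` each. -/
def circularGaussian (v : ℝ≥0) : Measure ℂ :=
  ((gaussianReal 0 (v / 2)).prod (gaussianReal 0 (v / 2))).map
    (fun p : ℝ × ℝ => (⟨p.1, p.2⟩ : ℂ))

/-- The mutual information `I(X; Y)` (in nats) of two random variables: the Kullback-Leibler
divergence of their joint law from the product of their marginal laws. -/
def mutualInformation {Ω E F : Type*} [MeasurableSpace Ω] [MeasurableSpace E] [MeasurableSpace F]
    (X : Ω → E) (Y : Ω → F) (μ : Measure Ω) : ℝ≥0∞ :=
  InformationTheory.klDiv (μ.map (fun ω => (X ω, Y ω))) ((μ.map X).prod (μ.map Y))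

/-- The normalized sinc function, `sin (π x) / (π x)`, with value `1` at `0`. -/
def normalizedSinc (x : ℝ) : ℝ := Real.sinc (Real.pi * x)

/-- The matrix `K_S`: rows are indexed by the sensor positions `x ∈ S`, columns by the retained
frequencies `m ∈ M`, and the entries are `sinc (m + (2 / lam) x)`. -/
def sensingMatrix (lam : ℝ) (M : Finset ℤ) (S : Finset ℝ) : Matrix S M ℂ :=
  fun x m => ((normalizedSinc ((m : ℤ) + 2 / lam * (x : ℝ)) : ℝ) : ℂ)

/-- The joint law of the coefficient vector `β` and of the noise vector `w`: all the components are
independent, `β_m ∼ CN(0, v m)` for `m ∈ M`, and the noise at each sensor is `CN(0, s)`. -/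
def modelLaw (v : ℤ → ℝ≥0) (s : ℝ≥0) (M : Finset ℤ) (S : Finset ℝ) :
    Measure ((M → ℂ) × (S → ℂ)) :=
  (Measure.pi (fun m : M => circularGaussian (v m))).prod
    (Measure.pi (fun _ : S => circularGaussian s))

/-- The vector of measurements `K_S β + w`, as a random variable in `ω = (β, w)`. -/
def measurements (lam : ℝ) (M : Finset ℤ) (S : Finset ℝ) (ω : (M → ℂ) × (S → ℂ)) : S → ℂ :=
  (sensingMatrix lam M S).mulVec ω.1 + ω.2

/-- The mutual information between the measurements taken at the positions in `S` and the
coefficient vector `β`. -/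
def designInformation (lam : ℝ) (v : ℤ → ℝ≥0) (s : ℝ≥0) (M : Finset ℤ) (S : Finset ℝ) : ℝ≥0∞ :=
  mutualInformation (measurements lam M S) Prod.fst (modelLaw v s M S)

/-- The designs allowed over `A`: sets of at most `N` sensor positions in `A`. -/
def designs (A : Set ℝ) (N : ℕ) : Set (Finset ℝ) := {S | (S : Set ℝ) ⊆ A ∧ S.card ≤ N}

/-- `S` maximizes the objective `G` over the designs with at most `N` positions in `A`. -/
def IsOptimalDesign (G : Finset ℝ → ℝ≥0∞) (A : Set ℝ) (N : ℕ) (S : Finset ℝ) : Prop :=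
  S ∈ designs A N ∧ ∀ T ∈ designs A N, G T ≤ G S

/-- The uniform grid with spacing `δ` and offset `c` in `A`: all the points `c + k δ`, `k ∈ ℤ`,
that lie in `A`. -/
def uniformGrid (A : Set ℝ) (c δ : ℝ) : Set ℝ := {x | x ∈ A ∧ ∃ k : ℤ, x = c + k * δ}

end

/-!
Adding Gaussian noise `w` to a linear image `K β` of a Gaussian vector has the same law as applying
to `w` an invertible real matrix `T` with `T Tᵀ = 1 + K D Kᵀ`, where `D` holds the signal-to-noise
ratios. The mutual information is the resulting change of entropy, `log |det T|` once for the real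
and once for the imaginary part, that is `log det (1 + A Aᵀ)` with `A = K D^{1/2}`.

Since the aperture is an interval whose grid has at least `N` points, at least `N` grid points lie
within `N δ` of every sensor, so by Hall's theorem the sensors of a design can be moved to distinct
grid points, each by at most `N δ`. Let `A` and `B` be the matrices before and after the move. By
concavity of `log det`, the loss is at most `n log (1 + tr ((1 + B Bᵀ)⁻¹ (A Aᵀ - B Bᵀ)) / n)`, and
since `0 ≤ (1 + B Bᵀ)⁻¹ ≤ 1`, twice this trace is at most the sum of
`c⁻¹ (A i j - B i j)² + c (A i j + B i j)²` over the entries, for any `c > 0`.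

Each entry is controlled by `sinc x = ∫₀¹ cos (x u) du`, which gives
`(sinc x - sinc y)² ≤ (x - y)² (4 - (sinc x + sinc y)²) / 12`: two sinc values that differ are not
both close to `1`. For the normalized sinc the constant `π² / 12` is at most `1`. With `c` the
distance moved in units of `λ / 2`, each entry then contributes at most `4 c` times its
signal-to-noise ratio, which is linear in the distance.
-/

section Sinc
open Real

theorem sinc_eq_integral_cos (t : ℝ) : sinc t = ∫ u in (0 : ℝ)..1, cos (t * u) := by
  rcases eq_or_ne t 0 with rfl | ht
  · simp
  · rw [intervalIntegral.integral_comp_mul_left _ ht, integral_cos, sinc_of_ne_zero ht]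
    simp [div_eq_inv_mul]

theorem mul_cos_sub_add_mul_cos_add_le (a b p q : ℝ) :
    a * (cos p - cos q) + b * (cos p + cos q) ≤ a ^ 2 * ((p - q) / 2) ^ 2 + b ^ 2 + 1 := by
  have hsin : a ^ 2 * sin ((p - q) / 2) ^ 2 ≤ a ^ 2 * ((p - q) / 2) ^ 2 :=
    mul_le_mul_of_nonneg_left (sq_le_sq.2 abs_sin_le_abs) (sq_nonneg a)
  have hcos : b ^ 2 * cos ((p - q) / 2) ^ 2 ≤ b ^ 2 :=
    mul_le_of_le_one_right (sq_nonneg b) (cos_sq_le_one _)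
  rw [cos_sub_cos, cos_add_cos]
  linarith [sq_nonneg (a * sin ((p - q) / 2) + sin ((p + q) / 2)),
    sq_nonneg (b * cos ((p - q) / 2) - cos ((p + q) / 2)), sin_sq_add_cos_sq ((p + q) / 2)]

theorem mul_sinc_sub_add_mul_sinc_add_le (a b x y : ℝ) :
    a * (sinc x - sinc y) + b * (sinc x + sinc y) ≤ a ^ 2 * (x - y) ^ 2 / 12 + b ^ 2 + 1 := by
  have hcos : ∀ t : ℝ, IntervalIntegrable (fun u => cos (t * u)) volume 0 1 := fun t =>
    Continuous.intervalIntegrable (by fun_prop) _ _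
  calc a * (sinc x - sinc y) + b * (sinc x + sinc y)
      = ∫ u in (0 : ℝ)..1, a * (cos (x * u) - cos (y * u)) + b * (cos (x * u) + cos (y * u)) := by
        rw [intervalIntegral.integral_add (((hcos x).sub (hcos y)).const_mul a)
            (((hcos x).add (hcos y)).const_mul b),
          intervalIntegral.integral_const_mul, intervalIntegral.integral_const_mul,
          intervalIntegral.integral_sub (hcos x) (hcos y),
          intervalIntegral.integral_add (hcos x) (hcos y)]
        simp only [sinc_eq_integral_cos]
    _ ≤ ∫ u in (0 : ℝ)..1, a ^ 2 * ((x * u - y * u) / 2) ^ 2 + b ^ 2 + 1 :=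
        intervalIntegral.integral_mono_on zero_le_one
          (Continuous.intervalIntegrable (by fun_prop) _ _)
          (Continuous.intervalIntegrable (by fun_prop) _ _)
          fun u _ => mul_cos_sub_add_mul_cos_add_le a b _ _
    _ = ∫ u in (0 : ℝ)..1, a ^ 2 * ((x - y) / 2) ^ 2 * u ^ 2 + (b ^ 2 + 1) := by
        congr 1 with u
        ring
    _ = a ^ 2 * (x - y) ^ 2 / 12 + b ^ 2 + 1 := by
        rw [intervalIntegral.integral_add (Continuous.intervalIntegrable (by fun_prop) _ _)
          (Continuous.intervalIntegrable (by fun_prop) _ _),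
          intervalIntegral.integral_const_mul, integral_pow, intervalIntegral.integral_const]
        norm_num
        ring

theorem sq_sinc_sub_le (x y : ℝ) :
    12 * (sinc x - sinc y) ^ 2 ≤ (x - y) ^ 2 * (4 - (sinc x + sinc y) ^ 2) := by
  rcases eq_or_ne x y with rfl | hxy
  · simp
  have hq : 0 < (x - y) ^ 2 := sq_pos_of_ne_zero (sub_ne_zero.2 hxy)
  -- These values of `a` and `b` make the bound optimal.
  have h := mul_sinc_sub_add_mul_sinc_add_le (6 * (sinc x - sinc y) / (x - y) ^ 2)
    ((sinc x + sinc y) / 2) x y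
  have hlin : 6 * (sinc x - sinc y) / (x - y) ^ 2 * (sinc x - sinc y) =
      6 * ((sinc x - sinc y) ^ 2 / (x - y) ^ 2) := by ring
  have hquad : (6 * (sinc x - sinc y) / (x - y) ^ 2) ^ 2 * (x - y) ^ 2 / 12 =
      3 * ((sinc x - sinc y) ^ 2 / (x - y) ^ 2) := by
    field_simp
    ring
  have : (sinc x - sinc y) ^ 2 / (x - y) ^ 2 ≤ (4 - (sinc x + sinc y) ^ 2) / 12 := by
    rw [hlin, hquad] at h
    linarith
  rw [div_le_iff₀ hq] at this
  linarith

theorem sq_normalizedSinc_add_le (x y : ℝ) : (normalizedSinc x + normalizedSinc y) ^ 2 ≤ 4 := by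
  have hx := abs_le.1 (abs_sinc_le_one (π * x))
  have hy := abs_le.1 (abs_sinc_le_one (π * y))
  unfold normalizedSinc
  nlinarith

theorem sq_normalizedSinc_sub_le (x y : ℝ) :
    (normalizedSinc x - normalizedSinc y) ^ 2 ≤
      (x - y) ^ 2 * (4 - (normalizedSinc x + normalizedSinc y) ^ 2) := by
  have h : 12 * (normalizedSinc x - normalizedSinc y) ^ 2 ≤
      (π * x - π * y) ^ 2 * (4 - (normalizedSinc x + normalizedSinc y) ^ 2) :=
    sq_sinc_sub_le (π * x) (π * y)
  have hπ : π ^ 2 ≤ 12 := by nlinarith [pi_pos, pi_lt_d2]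
  have := mul_le_mul_of_nonneg_right hπ
    (mul_nonneg (sq_nonneg (x - y)) (sub_nonneg.2 (sq_normalizedSinc_add_le x y)))
  rw [← mul_sub, mul_pow] at h
  linarith

theorem inv_mul_sq_normalizedSinc_sub_add_le {x y d : ℝ} (hd : 0 < d) (hxy : |x - y| ≤ d) :
    d⁻¹ * (normalizedSinc x - normalizedSinc y) ^ 2 +
      d * (normalizedSinc x + normalizedSinc y) ^ 2 ≤ 4 * d := by
  have hdiff : d⁻¹ * (normalizedSinc x - normalizedSinc y) ^ 2 ≤
      d * (4 - (normalizedSinc x + normalizedSinc y) ^ 2) := by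
    rw [inv_mul_le_iff₀ hd, ← mul_assoc, ← sq]
    exact (sq_normalizedSinc_sub_le x y).trans
      (mul_le_mul_of_nonneg_right (sq_le_sq' (neg_le_of_abs_le hxy) (le_of_abs_le hxy))
        (sub_nonneg.2 (sq_normalizedSinc_add_le x y)))
  linarith

end Sinc

section Matrix
open Matrix

variable {n m : Type*} [Fintype n] [Fintype m]

theorem trace_mul_mul_transpose_nonneg {X : Matrix n n ℝ} (hX : X.PosSemidef)
    (C : Matrix n m ℝ) : 0 ≤ (X * (C * Cᵀ)).trace := by
  rw [← Matrix.mul_assoc, trace_mul_comm, ← Matrix.mul_assoc]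
  simpa using (hX.conjTranspose_mul_mul_same C).trace_nonneg

theorem exists_transpose_mul_self_eq {X : Matrix n n ℝ} (hX : X.PosSemidef) :
    ∃ B : Matrix n n ℝ, Bᵀ * B = X := by
  classical
  open scoped MatrixOrder in
  obtain ⟨B, hB⟩ := CStarAlgebra.nonneg_iff_eq_star_mul_self.mp hX.nonneg
  exact ⟨B, by simpa [star_eq_conjTranspose] using hB.symm⟩

variable [DecidableEq n]

theorem log_det_le_of_trace_le {X : Matrix n n ℝ} (hX : X.PosDef) {a : ℝ} (ha : 0 < a)
    (htr : X.trace ≤ Fintype.card n * a) :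
    Real.log X.det ≤ Fintype.card n * Real.log a := by
  let μ := hX.isHermitian.eigenvalues
  have hμ : ∀ i, 0 < μ i := hX.eigenvalues_pos
  have hdet : X.det = ∏ i, μ i := hX.isHermitian.det_eq_prod_eigenvalues
  have htrace : X.trace = ∑ i, μ i := hX.isHermitian.trace_eq_sum_eigenvalues
  have hlog : ∀ i, Real.log (μ i) ≤ μ i / a - 1 + Real.log a := fun i => by
    have := Real.log_le_sub_one_of_pos (div_pos (hμ i) ha)
    rw [Real.log_div (hμ i).ne' ha.ne'] at this
    linarith
  calc Real.log X.det = ∑ i, Real.log (μ i) := by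
        rw [hdet, Real.log_prod fun i _ => (hμ i).ne']
    _ ≤ ∑ i, (μ i / a - 1 + Real.log a) := Finset.sum_le_sum fun i _ => hlog i
    _ = X.trace / a - Fintype.card n + Fintype.card n * Real.log a := by
        simp [Finset.sum_add_distrib, Finset.sum_sub_distrib, htrace, Finset.sum_div]
    _ ≤ Fintype.card n * Real.log a := by
        have := (div_le_iff₀ ha).2 htr
        linarith

theorem log_det_le_log_det_add {X Y : Matrix n n ℝ} (hX : X.PosDef) (hY : Y.PosDef) {a : ℝ}
    (ha : 0 < a) (htr : (Y⁻¹ * X).trace ≤ Fintype.card n * a) :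
    Real.log X.det ≤ Real.log Y.det + Fintype.card n * Real.log a := by
  obtain ⟨B, hB⟩ := exists_transpose_mul_self_eq hY.inv.posSemidef
  have hBdet : B.det ^ 2 = Y.det⁻¹ := by
    rw [← Ring.inverse_eq_inv', ← det_nonsing_inv, ← hB, det_mul, det_transpose, sq]
  have hBunit : IsUnit B := (isUnit_iff_isUnit_det B).2 <| isUnit_iff_ne_zero.2 fun h =>
    inv_ne_zero hY.det_pos.ne' (by rw [← hBdet, h, sq, mul_zero])
  have hZ : (B * X * Bᵀ).PosDef := by
    simpa using hX.mul_mul_conjTranspose_same (vecMul_injective_iff_isUnit.2 hBunit)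
  have hZdet : (B * X * Bᵀ).det = X.det / Y.det := by
    rw [det_mul, det_mul, det_transpose, div_eq_mul_inv, ← hBdet]
    ring
  have hZtrace : (B * X * Bᵀ).trace = (Y⁻¹ * X).trace := by
    rw [trace_mul_comm, ← Matrix.mul_assoc, hB]
  have := log_det_le_of_trace_le hZ ha (hZtrace ▸ htr)
  rw [hZdet, Real.log_div hX.det_pos.ne' hY.det_pos.ne'] at this
  linarith

theorem posDef_one_add_mul_transpose {k : Type*} [Finite k] [DecidableEq k]
    (A : Matrix k m ℝ) : (1 + A * Aᵀ).PosDef := by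
  have := Fintype.ofFinite k
  refine PosDef.one.add_posSemidef ?_
  simpa using posSemidef_self_mul_conjTranspose A

theorem posSemidef_one_sub_inv_one_add_mul_transpose (B : Matrix n m ℝ) :
    (1 - (1 + B * Bᵀ)⁻¹).PosSemidef := by
  classical
  have hC : (1 + Bᵀ * B).PosDef := by simpa using posDef_one_add_mul_transpose Bᵀ
  have hwoodbury : 1 - (1 + B * Bᵀ)⁻¹ = B * (1 + Bᵀ * B)⁻¹ * Bᵀ := by
    have := add_mul_mul_inv_eq_sub (A := (1 : Matrix n n ℝ)) (U := B) (C := (1 : Matrix m m ℝ))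
      (V := Bᵀ) isUnit_one isUnit_one (by simpa using hC.isUnit)
    simp only [Matrix.mul_one, inv_one, Matrix.one_mul] at this
    rw [this, sub_sub_cancel]
  rw [hwoodbury]
  simpa using hC.inv.posSemidef.mul_mul_conjTranspose_same B

theorem two_mul_trace_mul_sub_le {X : Matrix n n ℝ} (hX : X.PosSemidef)
    (hX' : (1 - X).PosSemidef) (A B : Matrix n m ℝ) {c : ℝ} (hc : 0 < c) :
    2 * (X * (A * Aᵀ - B * Bᵀ)).trace ≤
      ∑ i, ∑ j, (c⁻¹ * (A i j - B i j) ^ 2 + c * (A i j + B i j) ^ 2) := by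
  -- With `Δ = A - B` and `Σ = A + B` the left side is `Δ * Σᵀ + Σ * Δᵀ`: complete the square.
  have hsplit : (2 : ℝ) • (A * Aᵀ - B * Bᵀ) =
      c⁻¹ • ((A - B) * (A - B)ᵀ) + c • ((A + B) * (A + B)ᵀ) -
        c⁻¹ • ((A - B - c • (A + B)) * (A - B - c • (A + B))ᵀ) := by
    simp only [transpose_add, transpose_sub, transpose_smul, Matrix.mul_add, Matrix.add_mul,
      Matrix.mul_sub, Matrix.sub_mul, Matrix.smul_mul, Matrix.mul_smul]
    match_scalars <;> field_simp <;> ring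
  have hle : ∀ C : Matrix n m ℝ, (X * (C * Cᵀ)).trace ≤ ∑ i, ∑ j, C i j ^ 2 := fun C => by
    have := trace_mul_mul_transpose_nonneg hX' C
    rw [Matrix.sub_mul, Matrix.one_mul, trace_sub, sub_nonneg] at this
    refine this.trans_eq ?_
    simp only [trace, diag_apply, Matrix.mul_apply, transpose_apply, sq]
  calc 2 * (X * (A * Aᵀ - B * Bᵀ)).trace
      = c⁻¹ * (X * ((A - B) * (A - B)ᵀ)).trace + c * (X * ((A + B) * (A + B)ᵀ)).trace -
          c⁻¹ * (X * ((A - B - c • (A + B)) * (A - B - c • (A + B))ᵀ)).trace := by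
        rw [← smul_eq_mul 2, ← trace_smul, ← Matrix.mul_smul, hsplit]
        simp only [Matrix.mul_sub, Matrix.mul_add, Matrix.mul_smul, trace_sub, trace_add,
          trace_smul, smul_eq_mul]
    _ ≤ c⁻¹ * (X * ((A - B) * (A - B)ᵀ)).trace + c * (X * ((A + B) * (A + B)ᵀ)).trace :=
        sub_le_self _ (mul_nonneg (inv_nonneg.2 hc.le) (trace_mul_mul_transpose_nonneg hX _))
    _ ≤ c⁻¹ * ∑ i, ∑ j, (A - B) i j ^ 2 + c * ∑ i, ∑ j, (A + B) i j ^ 2 := by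
        gcongr <;> exact hle _
    _ = ∑ i, ∑ j, (c⁻¹ * (A i j - B i j) ^ 2 + c * (A i j + B i j) ^ 2) := by
        simp only [Finset.mul_sum, Finset.sum_add_distrib, Matrix.sub_apply, Matrix.add_apply]

theorem log_det_one_add_mul_transpose_le (A B : Matrix n m ℝ) {c t : ℝ} (hc : 0 < c) (ht : 0 ≤ t)
    (h : ∑ i, ∑ j, (c⁻¹ * (A i j - B i j) ^ 2 + c * (A i j + B i j) ^ 2) ≤
      2 * (Fintype.card n * t)) :
    Real.log (1 + A * Aᵀ).det ≤
      Real.log (1 + B * Bᵀ).det + Fintype.card n * Real.log (1 + t) := by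
  have hG := posDef_one_add_mul_transpose B
  refine log_det_le_log_det_add (posDef_one_add_mul_transpose A) hG (by linarith) ?_
  have hsub : 1 + A * Aᵀ = 1 + B * Bᵀ + (A * Aᵀ - B * Bᵀ) := by abel
  rw [hsub, Matrix.mul_add, trace_add, nonsing_inv_mul _ hG.det_pos.ne'.isUnit, trace_one]
  have := two_mul_trace_mul_sub_le hG.inv.posSemidef
    (posSemidef_one_sub_inv_one_add_mul_transpose B) A B hc
  linarith

end Matrix

section Density

theorem map_withDensity_comp {α β : Type*} [MeasurableSpace α] [MeasurableSpace β]
    {μ : Measure α} {f : α → β} (hf : Measurable f) {g : β → ℝ≥0∞} (hg : Measurable g) :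
    (μ.withDensity fun x => g (f x)).map f = (μ.map f).withDensity g := by
  ext t ht
  rw [Measure.map_apply hf ht, withDensity_apply _ (hf ht), withDensity_apply _ ht,
    setLIntegral_map ht hg hf]

theorem map_continuousLinearEquiv_addHaar {E : Type*} [NormedAddCommGroup E] [NormedSpace ℝ E]
    [FiniteDimensional ℝ E] [MeasurableSpace E] [BorelSpace E] (ρ : Measure E)
    [ρ.IsAddHaarMeasure] (T : E ≃L[ℝ] E) :
    ρ.map T = ENNReal.ofReal |LinearMap.det (T : E →ₗ[ℝ] E)|⁻¹ • ρ := by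
  rw [← abs_inv]
  exact Measure.map_linearMap_addHaar_eq_smul_addHaar ρ
      (LinearEquiv.isUnit_det' T.toLinearEquiv).ne_zero

theorem map_continuousLinearEquiv_withDensity {E : Type*} [NormedAddCommGroup E] [NormedSpace ℝ E]
    [FiniteDimensional ℝ E] [MeasurableSpace E] [BorelSpace E] (ρ : Measure E)
    [ρ.IsAddHaarMeasure] {g : E → ℝ≥0∞} (hg : Measurable g) (T : E ≃L[ℝ] E) :
    (ρ.withDensity g).map T = ρ.withDensity fun y =>
      ENNReal.ofReal |LinearMap.det (T : E →ₗ[ℝ] E)|⁻¹ * g (T.symm y) := by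
  have hgT : Measurable fun y => g (T.symm y) := hg.comp T.symm.continuous.measurable
  have h := map_withDensity_comp (μ := ρ) T.continuous.measurable hgT
  simp only [ContinuousLinearEquiv.symm_apply_apply] at h
  rw [h, map_continuousLinearEquiv_addHaar, withDensity_smul_measure,
    ← withDensity_smul _ hgT]
  rfl

theorem pi_withDensity_ofReal {ι : Type*} [Fintype ι] {E : ι → Type*}
    [∀ i, MeasurableSpace (E i)] (ρ : ∀ i, Measure (E i)) [∀ i, SigmaFinite (ρ i)]
    {g : ∀ i, E i → ℝ} (hg : ∀ i, Integrable (g i) (ρ i)) (hg0 : ∀ i z, 0 ≤ g i z) :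
    Measure.pi (fun i => (ρ i).withDensity fun z => ENNReal.ofReal (g i z)) =
      (Measure.pi ρ).withDensity fun z => ENNReal.ofReal (∏ i, g i (z i)) := by
  have := fun i => isFiniteMeasure_withDensity_ofReal (hg i).2
  refine Measure.pi_eq fun t ht => ?_
  rw [withDensity_apply _ (MeasurableSet.univ_pi ht), Measure.restrict_pi_pi,
    ← ofReal_integral_eq_lintegral_ofReal (Integrable.fintype_prod_dep fun i => (hg i).restrict)
      (Filter.Eventually.of_forall fun z => Finset.prod_nonneg fun i _ => hg0 i _),
    integral_fintype_prod_eq_prod, ENNReal.ofReal_prod_of_nonneg fun i _ => integral_nonneg (hg0 i)]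
  refine Finset.prod_congr rfl fun i _ => ?_
  rw [withDensity_apply _ (ht i), ofReal_integral_eq_lintegral_ofReal (hg i).restrict
    (Filter.Eventually.of_forall (hg0 i))]

theorem klDiv_withDensity_ofReal {α : Type*} [MeasurableSpace α] {κ : Measure α} {f r : α → ℝ}
    (hf : Measurable f) (hr : Measurable r) (hf0 : ∀ x, 0 < f x) (hr0 : ∀ x, 0 < r x)
    {J R : Measure α} [IsProbabilityMeasure J] [IsProbabilityMeasure R]
    (hJ : J = κ.withDensity fun x => ENNReal.ofReal (f x))
    (hR : R = κ.withDensity fun x => ENNReal.ofReal (r x))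
    (hlogf : Integrable (fun x => Real.log (f x)) J)
    (hlogr : Integrable (fun x => Real.log (r x)) J) :
    InformationTheory.klDiv J R =
      ENNReal.ofReal (∫ x, Real.log (f x) ∂J - ∫ x, Real.log (r x) ∂J) := by
  have hJR : J = R.withDensity fun x => ENNReal.ofReal (f x / r x) := by
    rw [hJ, hR, ← withDensity_mul _ hr.ennreal_ofReal (by fun_prop)]
    congr with x
    rw [Pi.mul_apply, ← ENNReal.ofReal_mul (hr0 x).le, mul_div_cancel₀ _ (hr0 x).ne']
  have hac : J ≪ R := hJR ▸ withDensity_absolutelyContinuous _ _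
  have hllr : llr J R =ᵐ[J] fun x => Real.log (f x) - Real.log (r x) := by
    have hrn : J.rnDeriv R =ᵐ[R] fun x => ENNReal.ofReal (f x / r x) := by
      rw [hJR]
      exact Measure.rnDeriv_withDensity R (hf.div hr).ennreal_ofReal
    filter_upwards [hac hrn] with x hx
    rw [llr, hx, ENNReal.toReal_ofReal (div_pos (hf0 x) (hr0 x)).le,
      Real.log_div (hf0 x).ne' (hr0 x).ne']
  rw [InformationTheory.klDiv_of_ac_of_integrable hac ((hlogf.sub hlogr).congr hllr.symm),
    integral_congr_ae hllr, integral_sub hlogf hlogr]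
  simp

end Density

section CircularGaussian

/-- The density of `circularGaussian v` with respect to Lebesgue measure on `ℂ`, used to express
mutual information through integrals of log densities. It vanishes identically for `v = 0`, where
the law is a Dirac mass. -/
noncomputable def circularGaussianPDF (v : ℝ≥0) (z : ℂ) : ℝ :=
  gaussianPDFReal 0 (v / 2) z.re * gaussianPDFReal 0 (v / 2) z.im

theorem circularGaussian_eq_map (v : ℝ≥0) :
    circularGaussian v = ((gaussianReal 0 (v / 2)).prod (gaussianReal 0 (v / 2))).map
      Complex.measurableEquivRealProd.symm := rfl

instance isProbabilityMeasure_circularGaussian (v : ℝ≥0) :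
    IsProbabilityMeasure (circularGaussian v) := by
  rw [circularGaussian_eq_map]
  exact Measure.isProbabilityMeasure_map (MeasurableEquiv.measurable _).aemeasurable

theorem measurable_circularGaussianPDF (v : ℝ≥0) : Measurable (circularGaussianPDF v) :=
  ((measurable_gaussianPDFReal _ _).comp Complex.measurable_re).mul
    ((measurable_gaussianPDFReal _ _).comp Complex.measurable_im)

theorem circularGaussianPDF_pos {v : ℝ≥0} (hv : v ≠ 0) (z : ℂ) : 0 < circularGaussianPDF v z :=
  mul_pos (gaussianPDFReal_pos _ _ _ (by simpa using hv))
    (gaussianPDFReal_pos _ _ _ (by simpa using hv))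

theorem integrable_circularGaussianPDF (v : ℝ≥0) : Integrable (circularGaussianPDF v) :=
  Complex.volume_preserving_equiv_real_prod.integrable_comp_of_integrable
    ((integrable_gaussianPDFReal 0 (v / 2)).mul_prod (integrable_gaussianPDFReal 0 (v / 2)))

theorem circularGaussian_eq_withDensity {v : ℝ≥0} (hv : v ≠ 0) :
    circularGaussian v = volume.withDensity fun z => ENNReal.ofReal (circularGaussianPDF v z) := by
  have hprod : (gaussianReal 0 (v / 2)).prod (gaussianReal 0 (v / 2)) =
      volume.withDensity fun p : ℝ × ℝ =>
        ENNReal.ofReal (circularGaussianPDF v (Complex.measurableEquivRealProd.symm p)) := by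
    rw [gaussianReal_of_var_ne_zero _ (by simpa using hv),
      prod_withDensity (measurable_gaussianPDF _ _) (measurable_gaussianPDF _ _)]
    simp only [gaussianPDF, ← ENNReal.ofReal_mul (gaussianPDFReal_nonneg _ _ _)]
    rfl
  rw [circularGaussian_eq_map, hprod, map_withDensity_comp (MeasurableEquiv.measurable _)
    (measurable_circularGaussianPDF v).ennreal_ofReal,
    Complex.volume_preserving_equiv_real_prod.symm.map_eq]

theorem integrable_log_gaussianPDFReal {v : ℝ≥0} (hv : v ≠ 0) :
    Integrable (fun x => Real.log (gaussianPDFReal 0 v x)) (gaussianReal 0 v) := by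
  have hlog : ∀ x, Real.log (gaussianPDFReal 0 v x) =
      Real.log (√(2 * Real.pi * v))⁻¹ - x ^ 2 / (2 * v) := fun x => by
    have : 0 < (v : ℝ) := by positivity
    rw [gaussianPDFReal, Real.log_mul (by positivity) (Real.exp_pos _).ne', Real.log_exp]
    ring
  simp_rw [hlog]
  exact (integrable_const _).sub
    ((memLp_id_gaussianReal' 2 (by simp)).integrable_sq.div_const _)

theorem integrable_log_circularGaussianPDF {v : ℝ≥0} (hv : v ≠ 0) :
    Integrable (fun z => Real.log (circularGaussianPDF v z)) (circularGaussian v) := by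
  have hv2 : v / 2 ≠ 0 := by simpa using hv
  have hlog := integrable_log_gaussianPDFReal hv2
  rw [circularGaussian_eq_map, integrable_map_equiv]
  exact ((hlog.comp_fst _).add (hlog.comp_snd _)).congr (Filter.Eventually.of_forall fun p =>
    (Real.log_mul (gaussianPDFReal_pos _ _ _ hv2).ne' (gaussianPDFReal_pos _ _ _ hv2).ne').symm)

variable {n : Type*} [Fintype n] {v : ℝ≥0}

theorem pi_circularGaussian_eq_withDensity (hv : v ≠ 0) :
    Measure.pi (fun _ : n => circularGaussian v) =
      volume.withDensity fun z => ENNReal.ofReal (∏ i, circularGaussianPDF v (z i)) := by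
  simp_rw [circularGaussian_eq_withDensity hv]
  exact pi_withDensity_ofReal _ (fun _ => integrable_circularGaussianPDF v)
    fun _ z => (circularGaussianPDF_pos hv z).le

theorem integrable_log_prod_circularGaussianPDF (hv : v ≠ 0) :
    Integrable (fun z : n → ℂ => Real.log (∏ i, circularGaussianPDF v (z i)))
      (Measure.pi fun _ => circularGaussian v) := by
  simp_rw [fun z : n → ℂ => Real.log_prod fun i (_ : i ∈ Finset.univ) =>
    (circularGaussianPDF_pos hv (z i)).ne']
  exact integrable_finsetSum _ fun i _ =>
    integrable_comp_eval (μ := fun _ : n => circularGaussian v) (i := i)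
      (integrable_log_circularGaussianPDF hv)

end CircularGaussian

section AdditiveNoise

theorem map_prod_withDensity_additiveNoise {E F : Type*} [AddGroup E] [MeasurableSpace E]
    [MeasurableAdd₂ E] [MeasurableNeg E] [MeasurableSpace F] {ρ : Measure E} [SFinite ρ]
    [ρ.IsAddLeftInvariant] {ν : Measure F} [SFinite ν] {g : E → ℝ≥0∞} (hg : Measurable g)
    {Φ : F → E} (hΦ : Measurable Φ) :
    (ν.prod (ρ.withDensity g)).map (fun ω => (Φ ω.1 + ω.2, ω.1)) =
      (ρ.prod ν).withDensity fun p => g (-Φ p.2 + p.1) := by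
  have hgΦ : Measurable fun p : E × F => g (-Φ p.2 + p.1) := by fun_prop
  have hshear : MeasurePreserving (fun ω : F × E => (Φ ω.1 + ω.2, ω.1))
      (ν.prod ρ) (ρ.prod ν) :=
    Measure.measurePreserving_swap.comp <| (MeasurePreserving.id ν).skew_product
      (g := fun b w => Φ b + w) (by fun_prop)
      (Filter.Eventually.of_forall fun b => map_add_left_eq_self ρ (Φ b))
  rw [prod_withDensity_right hg, ← hshear.map_eq,
    ← map_withDensity_comp hshear.measurable hgΦ]
  simp only [neg_add_cancel_left]

theorem mutualInformation_additiveNoise {E F : Type*} [AddGroup E] [MeasurableSpace E]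
    [MeasurableAdd₂ E] [MeasurableNeg E] [MeasurableSpace F] {ρ : Measure E} [SFinite ρ]
    [ρ.IsAddLeftInvariant] {ν : Measure F} [IsProbabilityMeasure ν] {γ Y : Measure E}
    [IsProbabilityMeasure γ] {g r : E → ℝ} (hg : Measurable g) (hr : Measurable r)
    (hg0 : ∀ y, 0 < g y) (hr0 : ∀ y, 0 < r y) {Φ : F → E} (hΦ : Measurable Φ)
    (hlaw : (ν.prod γ).map (fun ω => Φ ω.1 + ω.2) = Y)
    (hγ : γ = ρ.withDensity fun y => ENNReal.ofReal (g y))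
    (hY : Y = ρ.withDensity fun y => ENNReal.ofReal (r y))
    (hlogg : Integrable (fun y => Real.log (g y)) γ)
    (hlogr : Integrable (fun y => Real.log (r y)) Y) :
    mutualInformation (fun ω => Φ ω.1 + ω.2) Prod.fst (ν.prod γ) =
      ENNReal.ofReal (∫ y, Real.log (g y) ∂γ - ∫ y, Real.log (r y) ∂Y) := by
  have hsum : MeasurePreserving (fun ω : F × E => Φ ω.1 + ω.2) (ν.prod γ) Y :=
    ⟨by fun_prop, hlaw⟩
  have hpair : Measurable fun ω : F × E => (Φ ω.1 + ω.2, ω.1) := by fun_prop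
  have : IsProbabilityMeasure Y := hlaw ▸ Measure.isProbabilityMeasure_map hsum.aemeasurable
  have := Measure.isProbabilityMeasure_map (μ := ν.prod γ) hpair.aemeasurable
  set J := (ν.prod γ).map fun ω => (Φ ω.1 + ω.2, ω.1) with hJ
  have hnoise : MeasurePreserving (fun p : E × F => -Φ p.2 + p.1) J γ := by
    refine ⟨by fun_prop, ?_⟩
    rw [hJ, Measure.map_map (by fun_prop) hpair]
    simp only [Function.comp_def, neg_add_cancel_left]
    exact measurePreserving_snd.map_eq
  have hout : MeasurePreserving (Prod.fst : E × F → E) J Y := by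
    refine ⟨measurable_fst, ?_⟩
    rw [hJ, Measure.map_map measurable_fst hpair]
    exact hlaw
  have hJdensity : J = (ρ.prod ν).withDensity fun p => ENNReal.ofReal (g (-Φ p.2 + p.1)) := by
    rw [hJ, hγ, map_prod_withDensity_additiveNoise hg.ennreal_ofReal hΦ]
  have hYdensity : Y.prod ν = (ρ.prod ν).withDensity fun p => ENNReal.ofReal (r p.1) := by
    rw [hY, prod_withDensity_left hr.ennreal_ofReal]
  rw [mutualInformation, hlaw, measurePreserving_fst.map_eq,
    klDiv_withDensity_ofReal (hg.comp hnoise.measurable) (hr.comp measurable_fst)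
      (fun _ => hg0 _) (fun _ => hr0 _) hJdensity hYdensity
      (hnoise.integrable_comp_of_integrable hlogg) (hout.integrable_comp_of_integrable hlogr),
    ← hnoise.map_eq, ← hout.map_eq, integral_map hnoise.aemeasurable hg.log.aestronglyMeasurable,
    integral_map hout.aemeasurable hr.log.aestronglyMeasurable]
  rfl

theorem mutualInformation_additiveNoise_of_map_eq {E F : Type*} [NormedAddCommGroup E]
    [NormedSpace ℝ E] [FiniteDimensional ℝ E] [MeasurableSpace E] [BorelSpace E]
    [MeasurableSpace F] {ρ : Measure E} [ρ.IsAddHaarMeasure] {ν : Measure F}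
    [IsProbabilityMeasure ν] {γ : Measure E} [IsProbabilityMeasure γ] {g : E → ℝ}
    (hg : Measurable g) (hg0 : ∀ y, 0 < g y) {Φ : F → E} (hΦ : Measurable Φ) (T : E ≃L[ℝ] E)
    (hlaw : (ν.prod γ).map (fun ω => Φ ω.1 + ω.2) = γ.map T)
    (hγ : γ = ρ.withDensity fun y => ENNReal.ofReal (g y))
    (hlog : Integrable (fun y => Real.log (g y)) γ) :
    mutualInformation (fun ω => Φ ω.1 + ω.2) Prod.fst (ν.prod γ) =
      ENNReal.ofReal (Real.log |LinearMap.det (T : E →ₗ[ℝ] E)|) := by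
  set d := |LinearMap.det (T : E →ₗ[ℝ] E)|
  have hd : 0 < d := abs_pos.2 (LinearEquiv.isUnit_det' T.toLinearEquiv).ne_zero
  have hT : Measurable T := T.continuous.measurable
  have hr : Measurable fun y => d⁻¹ * g (T.symm y) :=
    (hg.comp T.symm.continuous.measurable).const_mul _
  have hlogr : ∀ y, Real.log (d⁻¹ * g (T.symm (T y))) = Real.log (g y) - Real.log d := fun y => by
    rw [Real.log_mul (inv_ne_zero hd.ne') (hg0 _).ne', Real.log_inv, T.symm_apply_apply,
      neg_add_eq_sub]
  have hY : γ.map T = ρ.withDensity fun y => ENNReal.ofReal (d⁻¹ * g (T.symm y)) := by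
    conv_lhs => rw [hγ]
    simp only [map_continuousLinearEquiv_withDensity ρ hg.ennreal_ofReal,
      ENNReal.ofReal_mul (inv_nonneg.2 hd.le)]
    rfl
  have hintegrable : Integrable (fun y => Real.log (d⁻¹ * g (T.symm y))) (γ.map T) := by
    rw [integrable_map_measure hr.log.aestronglyMeasurable hT.aemeasurable]
    simp only [Function.comp_def, hlogr]
    exact hlog.sub (integrable_const _)
  rw [mutualInformation_additiveNoise hg hr hg0 (fun y => mul_pos (inv_pos.2 hd) (hg0 _)) hΦ hlaw
    hγ hY hlog hintegrable, integral_map hT.aemeasurable hr.log.aestronglyMeasurable]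
  simp only [hlogr]
  rw [integral_sub hlog (integrable_const _)]
  simp

end AdditiveNoise

section GaussianChannel
open Matrix

theorem charFunDual_gaussianReal_zero (v : ℝ≥0) (L : StrongDual ℝ ℝ) :
    charFunDual (gaussianReal 0 v) L = Complex.exp (-((v * L 1 ^ 2 / 2 : ℝ) : ℂ)) := by
  rw [charFunDual_eq_charFun_map_one, gaussianReal_map_continuousLinearMap, charFun_gaussianReal]
  congr 1
  simp [sq_nonneg]
  ring

theorem charFunDual_circularGaussian (v : ℝ≥0) (L : StrongDual ℝ ℂ) :
    charFunDual (circularGaussian v) L =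
      Complex.exp (-((v * (L 1 ^ 2 + L Complex.I ^ 2) / 4 : ℝ) : ℂ)) := by
  have hmap : circularGaussian v = ((gaussianReal 0 (v / 2)).prod (gaussianReal 0 (v / 2))).map
      (Complex.equivRealProdCLM.symm : ℝ × ℝ →L[ℝ] ℂ) := rfl
  have hone : Complex.equivRealProdCLM.symm (1, 0) = 1 := by simp [Complex.ext_iff]
  have hI : Complex.equivRealProdCLM.symm (0, 1) = Complex.I := by simp [Complex.ext_iff]
  rw [hmap, charFunDual_map, charFunDual_prod, charFunDual_gaussianReal_zero,
    charFunDual_gaussianReal_zero, ← Complex.exp_add]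
  simp only [ContinuousLinearMap.comp_apply, ContinuousLinearMap.inl_apply,
    ContinuousLinearMap.inr_apply, ContinuousLinearEquiv.coe_coe, hone, hI]
  congr 1
  push_cast
  ring

theorem charFunDual_pi_circularGaussian {m : Type*} [Fintype m] [DecidableEq m] (v : m → ℝ≥0)
    (L : StrongDual ℝ (m → ℂ)) :
    charFunDual (Measure.pi fun j => circularGaussian (v j)) L =
      Complex.exp (-(((∑ j, (v j : ℝ) * (L (Pi.single j 1) ^ 2 + L (Pi.single j Complex.I) ^ 2)) /
        4 : ℝ) : ℂ)) := by
  simp only [charFunDual_pi, charFunDual_circularGaussian]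
  rw [← Complex.exp_sum, Finset.sum_neg_distrib, Finset.sum_div, Complex.ofReal_sum]
  rfl

variable {n m : Type*} [Fintype m]

/-- A real matrix acting on complex vectors, as a continuous linear map over `ℝ`: the channel of the
measurement model, to which real characteristic functions and Haar measure apply. -/
noncomputable def realMatrixCLM (A : Matrix n m ℝ) : (m → ℂ) →L[ℝ] (n → ℂ) :=
  LinearMap.toContinuousLinearMap
    ((Matrix.mulVecLin (A.map ((↑) : ℝ → ℂ))).restrictScalars ℝ)

theorem realMatrixCLM_apply (A : Matrix n m ℝ) (z : m → ℂ) :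
    realMatrixCLM A z = A.map ((↑) : ℝ → ℂ) *ᵥ z := rfl

variable [Fintype n]

theorem det_realMatrixCLM [DecidableEq n] (T : Matrix n n ℝ) :
    (realMatrixCLM T).det = T.det ^ 2 := by
  have hlin : (realMatrixCLM T : (n → ℂ) →ₗ[ℝ] (n → ℂ)) =
      (Matrix.toLin' (T.map ((↑) : ℝ → ℂ))).restrictScalars ℝ := rfl
  have hmap : (T.map ((↑) : ℝ → ℂ)).det = (T.det : ℂ) :=
    (RingHom.map_det Complex.ofRealHom T).symm
  rw [ContinuousLinearMap.det, hlin, LinearMap.det_restrictScalars, LinearMap.det_toLin', hmap,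
    Algebra.norm_complex_apply, Complex.normSq_ofReal, sq]

theorem map_realMatrixCLM_single [DecidableEq n] [DecidableEq m] (A : Matrix n m ℝ)
    (L : StrongDual ℝ (n → ℂ)) (j : m) (z : ℂ) :
    L (realMatrixCLM A (Pi.single j z)) = (Aᵀ *ᵥ fun i => L (Pi.single i z)) j := by
  have hcol : realMatrixCLM A (Pi.single j z) = ∑ i, A i j • (Pi.single i z : n → ℂ) := by
    rw [realMatrixCLM_apply, mulVec_single]
    funext i
    simp [Finset.sum_apply, Pi.single_apply, mul_comm]
  rw [hcol, map_sum]
  simp [mulVec, dotProduct]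

theorem charFunDual_map_realMatrixCLM [DecidableEq n] (v : m → ℝ≥0) (A : Matrix n m ℝ)
    (L : StrongDual ℝ (n → ℂ)) :
    charFunDual ((Measure.pi fun j => circularGaussian (v j)).map (realMatrixCLM A)) L =
      Complex.exp (-(((∑ j, (v j : ℝ) * ((Aᵀ *ᵥ fun i => L (Pi.single i 1)) j ^ 2 +
        (Aᵀ *ᵥ fun i => L (Pi.single i Complex.I)) j ^ 2)) / 4 : ℝ) : ℂ)) := by
  classical
  rw [charFunDual_map, charFunDual_pi_circularGaussian]
  simp only [ContinuousLinearMap.comp_apply, map_realMatrixCLM_single]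

theorem map_additiveNoise_eq_map_realMatrixCLM (v : m → ℝ≥0) (s : ℝ≥0) (K : Matrix n m ℝ)
    (T : Matrix n n ℝ)
    (h : ∀ a : n → ℝ, ∑ j, (v j : ℝ) * (Kᵀ *ᵥ a) j ^ 2 + ∑ i, (s : ℝ) * a i ^ 2 =
      ∑ i, (s : ℝ) * (Tᵀ *ᵥ a) i ^ 2) :
    ((Measure.pi fun j => circularGaussian (v j)).prod
        (Measure.pi fun _ : n => circularGaussian s)).map
          (fun ω => realMatrixCLM K ω.1 + ω.2) =
      (Measure.pi fun _ : n => circularGaussian s).map (realMatrixCLM T) := by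
  classical
  set ν := Measure.pi fun j => circularGaussian (v j) with hν
  set γ := Measure.pi fun _ : n => circularGaussian s with hγ
  have hK := (realMatrixCLM K).measurable
  have := Measure.isProbabilityMeasure_map (μ := ν) hK.aemeasurable
  have := Measure.isProbabilityMeasure_map (μ := γ) (realMatrixCLM T).measurable.aemeasurable
  have hconv : (ν.prod γ).map (fun ω => realMatrixCLM K ω.1 + ω.2) =
      (ν.map (realMatrixCLM K)).conv γ := by
    conv_rhs => rw [← Measure.map_id (μ := γ)]
    rw [Measure.conv, Measure.map_prod_map ν γ hK measurable_id,
      Measure.map_map (by fun_prop) (by fun_prop)]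
    rfl
  rw [hconv]
  refine Measure.ext_of_charFunDual (funext fun L => ?_)
  rw [charFunDual_conv, hν, hγ, charFunDual_map_realMatrixCLM, charFunDual_pi_circularGaussian,
    charFunDual_map_realMatrixCLM, ← Complex.exp_add, ← neg_add, ← Complex.ofReal_add, ← add_div]
  simp only [mul_add, Finset.sum_add_distrib]
  rw [← h, ← h, add_add_add_comm]

theorem sum_mul_sq_mulVec_transpose [DecidableEq n] [DecidableEq m] {v : m → ℝ≥0} {s : ℝ≥0}
    (hs : s ≠ 0) {K : Matrix n m ℝ} {B : Matrix n n ℝ}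
    (hB : Bᵀ * B = 1 + K * diagonal (fun j => (v j / s : ℝ)) * Kᵀ) (a : n → ℝ) :
    ∑ j, (v j : ℝ) * (Kᵀ *ᵥ a) j ^ 2 + ∑ i, (s : ℝ) * a i ^ 2 = ∑ i, (s : ℝ) * (B *ᵥ a) i ^ 2 := by
  have hquad : (B *ᵥ a) ⬝ᵥ (B *ᵥ a) =
      a ⬝ᵥ a + (Kᵀ *ᵥ a) ⬝ᵥ (diagonal (fun j => (v j / s : ℝ)) *ᵥ (Kᵀ *ᵥ a)) := by
    calc (B *ᵥ a) ⬝ᵥ (B *ᵥ a) = a ⬝ᵥ ((Bᵀ * B) *ᵥ a) := by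
          rw [← mulVec_mulVec, dotProduct_mulVec a, vecMul_transpose]
      _ = _ := by
          rw [hB, add_mulVec, one_mulVec, dotProduct_add, ← mulVec_mulVec, ← mulVec_mulVec,
            dotProduct_mulVec a K, ← mulVec_transpose K]
  have hscale : ∑ j, (v j : ℝ) * (Kᵀ *ᵥ a) j ^ 2 =
      s * ∑ j, (Kᵀ *ᵥ a) j * (v j / s * (Kᵀ *ᵥ a) j) := by
    have : (s : ℝ) ≠ 0 := mod_cast hs
    rw [Finset.mul_sum]
    refine Finset.sum_congr rfl fun j _ => ?_
    field_simp
  simp only [dotProduct, mulVec_diagonal, ← sq] at hquad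
  rw [hscale, ← Finset.mul_sum, ← Finset.mul_sum, hquad]
  ring

theorem mutualInformation_gaussianChannel [DecidableEq n] [DecidableEq m] (v : m → ℝ≥0)
    {s : ℝ≥0} (hs : s ≠ 0) (K : Matrix n m ℝ) :
    mutualInformation (fun ω : (m → ℂ) × (n → ℂ) => realMatrixCLM K ω.1 + ω.2) Prod.fst
      ((Measure.pi fun j => circularGaussian (v j)).prod
        (Measure.pi fun _ : n => circularGaussian s)) =
    ENNReal.ofReal (Real.log (1 + K * diagonal (fun j => (v j / s : ℝ)) * Kᵀ).det) := by
  set G := 1 + K * diagonal (fun j => (v j / s : ℝ)) * Kᵀ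
  have hGpos : G.PosDef := by
    have hdiag := PosSemidef.diagonal (n := m) (d := fun j => (v j / s : ℝ)) fun j => by positivity
    simpa using PosDef.one.add_posSemidef (hdiag.mul_mul_conjTranspose_same K)
  obtain ⟨B, hB⟩ := exists_transpose_mul_self_eq hGpos.posSemidef
  have hdet : (realMatrixCLM Bᵀ).det = G.det := by
    rw [det_realMatrixCLM, ← hB, det_mul, det_transpose, sq]
  let T := (realMatrixCLM Bᵀ).toContinuousLinearEquivOfDetNeZero (hdet ▸ hGpos.det_pos.ne')
  have hlaw := map_additiveNoise_eq_map_realMatrixCLM v s K Bᵀ fun a => by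
    rw [transpose_transpose]
    exact sum_mul_sq_mulVec_transpose hs hB a
  have hpdf : Measurable fun z : n → ℂ => ∏ i, circularGaussianPDF s (z i) :=
    Finset.measurable_prod _ fun i _ =>
      (measurable_circularGaussianPDF s).comp (measurable_pi_apply i)
  have hT : LinearMap.det (T : (n → ℂ) →ₗ[ℝ] (n → ℂ)) = G.det := hdet
  rw [mutualInformation_additiveNoise_of_map_eq hpdf
    (fun z => Finset.prod_pos fun i _ => circularGaussianPDF_pos hs (z i))
    (realMatrixCLM K).measurable T hlaw (pi_circularGaussian_eq_withDensity hs)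
    (integrable_log_prod_circularGaussianPDF hs), hT, abs_of_pos hGpos.det_pos]

end GaussianChannel

section Design
open Matrix

/-- The real matrix with entries `√(v m / s) * sinc (m + (2 / lam) * x i)`: the sensing matrix at
the positions `x`, with its columns scaled by the prior standard deviations relative to the
noise. The information of a design is `log det (1 + A * Aᵀ)` for this matrix `A`. -/
noncomputable def scaledSensingMatrix {ι : Type*} (lam : ℝ) (v : ℤ → ℝ≥0) (s : ℝ≥0)
    (M : Finset ℤ) (x : ι → ℝ) : Matrix ι M ℝ :=
  fun i m => √(v m / s) * normalizedSinc ((m : ℤ) + 2 / lam * x i)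

theorem designInformation_eq (lam : ℝ) (v : ℤ → ℝ≥0) {s : ℝ≥0} (hs : s ≠ 0) (M : Finset ℤ)
    (S : Finset ℝ) :
    designInformation lam v s M S = ENNReal.ofReal (Real.log
      (1 + scaledSensingMatrix lam v s M ((↑) : S → ℝ) *
        (scaledSensingMatrix lam v s M ((↑) : S → ℝ))ᵀ).det) := by
  let K : Matrix S M ℝ := fun x m => normalizedSinc ((m : ℤ) + 2 / lam * (x : ℝ))
  have hscaled : scaledSensingMatrix lam v s M ((↑) : S → ℝ) =
      K * diagonal (fun m : M => √(v m / s)) := by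
    ext i m
    rw [mul_diagonal, mul_comm]
    rfl
  have hprod : K * diagonal (fun m : M => (v m / s : ℝ)) * Kᵀ =
      scaledSensingMatrix lam v s M ((↑) : S → ℝ) *
        (scaledSensingMatrix lam v s M ((↑) : S → ℝ))ᵀ := by
    simp_rw [hscaled, transpose_mul, diagonal_transpose, ← Matrix.mul_assoc,
      Matrix.mul_assoc K (diagonal _) (diagonal _), diagonal_mul_diagonal,
      fun m : M => Real.mul_self_sqrt (show 0 ≤ (v m / s : ℝ) by positivity)]
  rw [← hprod]
  exact mutualInformation_gaussianChannel (fun m : M => v m) hs K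

theorem designInformation_map_eq (lam : ℝ) (v : ℤ → ℝ≥0) {s : ℝ≥0} (hs : s ≠ 0) (M : Finset ℤ)
    {ι : Type*} [Fintype ι] [DecidableEq ι] (x : ι ↪ ℝ) :
    designInformation lam v s M (Finset.univ.map x) = ENNReal.ofReal (Real.log
      (1 + scaledSensingMatrix lam v s M x * (scaledSensingMatrix lam v s M x)ᵀ).det) := by
  let e : ι ≃ (Finset.univ.map x : Finset ℝ) :=
    Equiv.ofBijective (fun i => ⟨x i, Finset.mem_map_of_mem x (Finset.mem_univ i)⟩)
      ⟨fun i j h => x.injective (congrArg Subtype.val h), fun ⟨y, hy⟩ => by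
        obtain ⟨i, -, rfl⟩ := Finset.mem_map.1 hy
        exact ⟨i, rfl⟩⟩
  have he : ∀ i, (e i : ℝ) = x i := fun _ => rfl
  rw [designInformation_eq lam v hs, ← det_submatrix_equiv_self e]
  congr 4
  ext i j
  simp [one_apply, Matrix.mul_apply, scaledSensingMatrix, he]

theorem inv_mul_sq_scaledSensingMatrix_sub_add_le {ι : Type*} {lam : ℝ} (hlam : 0 < lam)
    (v : ℤ → ℝ≥0) (s : ℝ≥0) (M : Finset ℤ) {x y : ι → ℝ} {d : ℝ} (hd : 0 < d) {i : ι}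
    (hxy : |x i - y i| ≤ d) (m : M) :
    (2 * d / lam)⁻¹ *
        (scaledSensingMatrix lam v s M x i m - scaledSensingMatrix lam v s M y i m) ^ 2 +
      2 * d / lam *
        (scaledSensingMatrix lam v s M x i m + scaledSensingMatrix lam v s M y i m) ^ 2 ≤
      v m / s * (4 * (2 * d / lam)) := by
  have harg : |((m : ℤ) + 2 / lam * x i : ℝ) - ((m : ℤ) + 2 / lam * y i)| ≤ 2 * d / lam := by
    rw [add_sub_add_left_eq_sub, ← mul_sub, abs_mul, abs_of_pos (by positivity), mul_div_right_comm]
    gcongr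
  have hsqrt : √(v m / s : ℝ) ^ 2 = v m / s := Real.sq_sqrt (by positivity)
  have h := mul_le_mul_of_nonneg_left
    (inv_mul_sq_normalizedSinc_sub_add_le (by positivity) harg) (sq_nonneg √(v m / s : ℝ))
  rw [hsqrt] at h
  refine le_of_eq_of_le ?_ h
  rw [← hsqrt]
  unfold scaledSensingMatrix
  ring

theorem designInformation_le_map_add {lam : ℝ} (hlam : 0 < lam) {s : ℝ≥0} (hs : 0 < s)
    {v : ℤ → ℝ≥0} {M : Finset ℤ} {P : ℝ} (hP : ∑ m ∈ M, (v m : ℝ) ≤ P) {d : ℝ} (hd : 0 < d)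
    {S : Finset ℝ} (y : S ↪ ℝ) (hy : ∀ x : S, |(x : ℝ) - y x| ≤ d) :
    designInformation lam v s M S ≤ designInformation lam v s M (Finset.univ.map y) +
      ENNReal.ofReal (S.card * Real.log (1 + 4 * d * P / (lam * s))) := by
  have hP0 : 0 ≤ P := (Finset.sum_nonneg fun m _ => NNReal.coe_nonneg (v m)).trans hP
  rw [designInformation_eq lam v hs.ne', designInformation_map_eq lam v hs.ne',
    ← Fintype.card_coe S]
  refine (ENNReal.ofReal_le_ofReal ?_).trans ENNReal.ofReal_add_le
  refine log_det_one_add_mul_transpose_le _ _ (c := 2 * d / lam) (by positivity) (by positivity) ?_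
  calc _ ≤ ∑ _ : S, ∑ m : M, (v m / s : ℝ) * (4 * (2 * d / lam)) :=
        Finset.sum_le_sum fun i _ => Finset.sum_le_sum fun m _ =>
          inv_mul_sq_scaledSensingMatrix_sub_add_le hlam v s M hd (hy i) m
    _ = Fintype.card S * ((∑ m ∈ M, (v m : ℝ)) / s * (4 * (2 * d / lam))) := by
        rw [← Finset.sum_mul, ← Finset.sum_div, Finset.sum_coe_sort M fun m => (v m : ℝ),
          Finset.sum_const, Finset.card_univ, nsmul_eq_mul]
    _ ≤ Fintype.card S * (P / s * (4 * (2 * d / lam))) := by gcongr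
    _ = 2 * (Fintype.card S * (4 * d * P / (lam * s))) := by field_simp

end Design

section Grid

theorem uniformGrid_subset (A : Set ℝ) (c δ : ℝ) : uniformGrid A c δ ⊆ A := fun _ h => h.1

theorem uniformGrid_mono {A B : Set ℝ} (h : A ⊆ B) (c δ : ℝ) :
    uniformGrid A c δ ⊆ uniformGrid B c δ := fun _ hx => ⟨h hx.1, hx.2⟩

theorem uniformGrid_Ioc (a b c : ℝ) {δ : ℝ} (hδ : 0 < δ) :
    uniformGrid (Set.Ioc a b) c δ =
      (fun k : ℤ => c + k * δ) '' Set.Ioc ⌊(a - c) / δ⌋ ⌊(b - c) / δ⌋ := by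
  have hmem : ∀ k : ℤ, k ∈ Set.Ioc ⌊(a - c) / δ⌋ ⌊(b - c) / δ⌋ ↔ c + k * δ ∈ Set.Ioc a b :=
    fun k => by
      rw [Set.mem_Ioc, Set.mem_Ioc, Int.floor_lt, Int.le_floor, div_lt_iff₀ hδ, le_div_iff₀ hδ,
        sub_lt_iff_lt_add', le_sub_iff_add_le']
  ext x
  constructor
  · rintro ⟨hx, k, rfl⟩
    exact ⟨k, (hmem k).2 hx, rfl⟩
  · rintro ⟨k, hk, rfl⟩
    exact ⟨(hmem k).1 hk, k, rfl⟩

theorem ncard_uniformGrid_Ioc (a c : ℝ) {δ : ℝ} (hδ : 0 < δ) (N : ℕ) :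
    (uniformGrid (Set.Ioc a (a + N * δ)) c δ).ncard = N := by
  have hinj : Function.Injective fun k : ℤ => c + k * δ := fun j k h =>
    Int.cast_injective (mul_right_cancel₀ hδ.ne' (add_left_cancel h))
  have hend : (a + N * δ - c) / δ = (a - c) / δ + N := by
    field_simp
    ring
  rw [uniformGrid_Ioc _ _ _ hδ, Set.ncard_image_of_injective _ hinj, hend, Int.floor_add_natCast,
    ← Finset.coe_Ioc, Set.ncard_coe_finset, Int.card_Ioc, add_sub_cancel_left, Int.toNat_natCast]

theorem finite_uniformGrid {A : Set ℝ} (hA : Bornology.IsBounded A) (c : ℝ) {δ : ℝ} (hδ : 0 < δ) :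
    (uniformGrid A c δ).Finite := by
  obtain ⟨b, hb⟩ := hA.bddAbove
  obtain ⟨a, ha⟩ := hA.bddBelow
  have hIoc : A ⊆ Set.Ioc (a - 1) b := fun x hx => ⟨(sub_one_lt a).trans_le (ha hx), hb hx⟩
  refine Set.Finite.subset ?_ (uniformGrid_mono hIoc c δ)
  rw [uniformGrid_Ioc _ _ _ hδ]
  exact (Set.finite_Ioc _ _).image _

theorem le_ncard_uniformGrid_inter_closedBall {A : Set ℝ} (hA : A.OrdConnected) {N : ℕ} {c δ : ℝ}
    (hδ : 0 < δ) (hN : N ≤ (uniformGrid A c δ).ncard) {x : ℝ} (hx : x ∈ A) :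
    N ≤ (uniformGrid (A ∩ Metric.closedBall x (N * δ)) c δ).ncard := by
  have hfin : (uniformGrid (A ∩ Metric.closedBall x (N * δ)) c δ).Finite :=
    finite_uniformGrid (Metric.isBounded_closedBall.subset Set.inter_subset_right) c hδ
  have hIoc : ∀ a, Set.Ioc a (a + N * δ) ⊆ A ∩ Metric.closedBall x (N * δ) →
      N ≤ (uniformGrid (A ∩ Metric.closedBall x (N * δ)) c δ).ncard := fun a ha =>
    (ncard_uniformGrid_Ioc a c hδ N).ge.trans (Set.ncard_le_ncard (uniformGrid_mono ha c δ) hfin)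
  by_cases hnear : uniformGrid A c δ ⊆ Metric.closedBall x (N * δ)
  · exact hN.trans (Set.ncard_le_ncard (fun y hy => ⟨⟨hy.1, hnear hy⟩, hy.2⟩) hfin)
  -- A grid point of `A` farther than `N * δ` from `x` puts a one-sided neighbourhood of `x` in `A`.
  obtain ⟨y, hy, hxy⟩ := Set.not_subset.1 hnear
  rw [Metric.mem_closedBall, Real.dist_eq, not_le] at hxy
  rcases lt_abs.1 hxy with h | h
  · refine hIoc x fun z hz => ⟨hA.out hx hy.1 ⟨hz.1.le, by linarith [hz.2]⟩, ?_⟩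
    rw [Real.closedBall_eq_Icc]
    exact ⟨by linarith [hz.1, mul_nonneg N.cast_nonneg hδ.le], hz.2⟩
  · refine hIoc (x - N * δ) fun z hz =>
      ⟨hA.out hy.1 hx ⟨by linarith [hz.1], by linarith [hz.2]⟩, ?_⟩
    rw [Real.closedBall_eq_Icc]
    exact ⟨hz.1.le, by linarith [hz.2, mul_nonneg N.cast_nonneg hδ.le]⟩

theorem exists_embedding_uniformGrid {A : Set ℝ} (hA : A.OrdConnected) {N : ℕ} {c δ : ℝ}
    (hδ : 0 < δ) (hN : N ≤ (uniformGrid A c δ).ncard) {S : Finset ℝ} (hS : S ∈ designs A N) :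
    ∃ y : S ↪ ℝ, (∀ x, y x ∈ uniformGrid A c δ) ∧ ∀ x : S, |(x : ℝ) - y x| ≤ N * δ := by
  have hfin : ∀ x : S, (uniformGrid (A ∩ Metric.closedBall (x : ℝ) (N * δ)) c δ).Finite := fun x =>
    finite_uniformGrid (Metric.isBounded_closedBall.subset Set.inter_subset_right) c hδ
  have hcard : ∀ x : S, N ≤ (hfin x).toFinset.card := fun x => by
    rw [← Set.ncard_eq_toFinset_card _ (hfin x)]
    exact le_ncard_uniformGrid_inter_closedBall hA hδ hN (hS.1 x.2)
  obtain ⟨y, hy, hyfin⟩ :=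
    (Finset.all_card_le_biUnion_card_iff_exists_injective fun x => (hfin x).toFinset).1 fun U => by
      rcases U.eq_empty_or_nonempty with rfl | ⟨x, hx⟩
      · simp
      calc U.card ≤ Fintype.card S := Finset.card_le_univ U
        _ ≤ N := (Fintype.card_coe S).trans_le hS.2
        _ ≤ (hfin x).toFinset.card := hcard x
        _ ≤ _ := Finset.card_le_card (Finset.subset_biUnion_of_mem (fun x => (hfin x).toFinset) hx)
  have hgrid := fun x => (hfin x).mem_toFinset.1 (hyfin x)
  refine ⟨⟨y, hy⟩, fun x => ⟨(hgrid x).1.1, (hgrid x).2⟩, fun x => ?_⟩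
  rw [abs_sub_comm]
  exact (hgrid x).1.2

end Grid

section OptimalDesign

theorem designs_mono {A B : Set ℝ} (h : A ⊆ B) (N : ℕ) : designs A N ⊆ designs B N :=
  fun _ hS => ⟨hS.1.trans h, hS.2⟩

theorem exists_isOptimalDesign {V : Set ℝ} (hV : V.Finite) (G : Finset ℝ → ℝ≥0∞) (N : ℕ) :
    ∃ S, IsOptimalDesign G V N S := by
  have hfin : (designs V N).Finite := (hV.toFinset.powerset.finite_toSet).subset fun S hS => by
    simpa [Set.subset_def, Finset.subset_iff] using hS.1
  exact Set.exists_max_image _ G hfin ⟨∅, by simp [designs]⟩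

theorem designInformation_le_add_of_isOptimalDesign {A : Set ℝ} (hA : A.OrdConnected) {N : ℕ}
    {lam : ℝ} (hlam : 0 < lam) {s : ℝ≥0} (hs : 0 < s) {v : ℤ → ℝ≥0} {M : Finset ℤ} {P : ℝ}
    (hP : ∑ m ∈ M, (v m : ℝ) ≤ P) {c δ : ℝ} (hδ : 0 < δ) (hN : N ≤ (uniformGrid A c δ).ncard)
    {Sd : Finset ℝ}
    (hSd : IsOptimalDesign (designInformation lam v s M) (uniformGrid A c δ) N Sd)
    {S : Finset ℝ} (hS : S ∈ designs A N) :
    designInformation lam v s M S ≤ designInformation lam v s M Sd +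
      ENNReal.ofReal (N * Real.log (1 + 4 * (N * δ) * P / (lam * s))) := by
  have hP0 : 0 ≤ P := (Finset.sum_nonneg fun m _ => NNReal.coe_nonneg (v m)).trans hP
  rcases N.eq_zero_or_pos with rfl | hNpos
  · obtain rfl : S = ∅ := Finset.card_eq_zero.1 (Nat.le_zero.1 hS.2)
    exact le_add_right (hSd.2 ∅ ⟨by simp, by simp⟩)
  obtain ⟨y, hygrid, hy⟩ := exists_embedding_uniformGrid hA hδ hN hS
  refine (designInformation_le_map_add hlam hs hP (by positivity) y hy).trans ?_
  gcongr
  · refine hSd.2 _ ⟨fun z hz => ?_, by simpa using hS.2⟩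
    obtain ⟨x, -, rfl⟩ := Finset.mem_map.1 (Finset.mem_coe.1 hz)
    exact hygrid x
  · exact Real.log_nonneg (le_add_of_nonneg_right (by positivity))
  · exact hS.2

theorem mul_log_one_add_le {N : ℕ} {δ P q : ℝ} (hδ : 0 ≤ δ) (hP : 0 ≤ P) (hq : 0 ≤ q) :
    N * Real.log (1 + 4 * (N * δ) * P / q) ≤
      N * Real.log (1 + 4 * δ * P * (1 + δ) * (N : ℝ) ^ (3 / 2 : ℝ) / q) := by
  rcases N.eq_zero_or_pos with rfl | hN
  · simp
  have hpow : (N : ℝ) ≤ (N : ℝ) ^ (3 / 2 : ℝ) :=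
    Real.self_le_rpow_of_one_le (mod_cast hN) (by norm_num)
  have hmul : 4 * (N * δ) * P ≤ 4 * δ * P * (1 + δ) * (N : ℝ) ^ (3 / 2 : ℝ) :=
    calc 4 * (N * δ) * P = 4 * δ * P * 1 * N := by ring
      _ ≤ 4 * δ * P * (1 + δ) * (N : ℝ) ^ (3 / 2 : ℝ) := by
          gcongr
          linarith
  gcongr

end OptimalDesign

theorem lemma2
    (A : Set ℝ) (hA : A.OrdConnected) (hAb : Bornology.IsBounded A)
    (N : ℕ) (lam : ℝ) (hlam : 0 < lam) (s : ℝ≥0) (hs : 0 < s)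
    (v : ℤ → ℝ≥0) (P : ℝ) (hP : HasSum (fun m => (v m : ℝ)) P) (M : Finset ℤ)
    (c δ : ℝ) (hδ : 0 < δ) (hN : N ≤ (uniformGrid A c δ).ncard) :
    (∀ S : Finset ℝ, designInformation lam v s M S ≠ ∞) ∧
    (∃ Sd : Finset ℝ,
      IsOptimalDesign (designInformation lam v s M) (uniformGrid A c δ) N Sd) ∧
    ∀ Sd : Finset ℝ,
      IsOptimalDesign (designInformation lam v s M) (uniformGrid A c δ) N Sd →
      (designInformation lam v s M Sd ≤ ⨆ S ∈ designs A N, designInformation lam v s M S) ∧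
      ((⨆ S ∈ designs A N, designInformation lam v s M S) ≤
        designInformation lam v s M Sd +
          ENNReal.ofReal (N * Real.log
            (1 + 4 * δ * P * (1 + δ) * (N : ℝ) ^ (3 / 2 : ℝ) / (lam * s)))) ∧
      ∀ Sopt : Finset ℝ,
        IsOptimalDesign (designInformation lam v s M) A N Sopt →
        designInformation lam v s M Sd ≤ designInformation lam v s M Sopt ∧
        designInformation lam v s M Sopt ≤
          designInformation lam v s M Sd +
            ENNReal.ofReal (N * Real.log
              (1 + 4 * δ * P * (1 + δ) * (N : ℝ) ^ (3 / 2 : ℝ) / (lam * s))) := by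
  have hPM : ∑ m ∈ M, (v m : ℝ) ≤ P := sum_le_hasSum M (fun m _ => NNReal.coe_nonneg (v m)) hP
  have hsub := designs_mono (uniformGrid_subset A c δ) N
  refine ⟨fun S => ?_, exists_isOptimalDesign (finite_uniformGrid hAb c hδ) _ N, fun Sd hSd => ?_⟩
  · rw [designInformation_eq lam v hs.ne']
    exact ENNReal.ofReal_ne_top
  have hbound : ∀ S ∈ designs A N, designInformation lam v s M S ≤
      designInformation lam v s M Sd + ENNReal.ofReal (N * Real.log
        (1 + 4 * δ * P * (1 + δ) * (N : ℝ) ^ (3 / 2 : ℝ) / (lam * s))) := fun S hS => by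
    refine (designInformation_le_add_of_isOptimalDesign hA hlam hs hPM hδ hN hSd hS).trans ?_
    refine add_le_add le_rfl (ENNReal.ofReal_le_ofReal ?_)
    exact mul_log_one_add_le hδ.le (hP.nonneg fun m => NNReal.coe_nonneg (v m)) (by positivity)
  exact ⟨le_iSup₂_of_le Sd (hsub hSd.1) le_rfl, iSup₂_le hbound, fun Sopt hopt =>
    ⟨hopt.2 Sd (hsub hSd.1), hbound Sopt hopt.1⟩⟩
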